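/- Let $n,J,L\in\mathbb N$ and $m\in\mathbb N$, and let $P=(P_{jl})\in\mathbb C[z]^{J\times L}$, $z=(z_1,\dots,z_n)$, be a matrix of polynomials each of whose nonzero entries is homogeneous of degree $m$. Let $$M:=P^t\,\mathbb C[z]^J=\bigcap_{\sigma=1}^{\mu}M_\sigma\subset\mathbb C[z]^L$$ be a primary decomposition, let $\mathfrak p_\sigma=\sqrt{\operatorname{Ann}(\mathbb C[z]^L/M_\sigma)}$ be the prime ideal associated with the primary submodule $M_\sigma$, and let $V_{\mathfrak p_\sigma}\subset\mathbb C^n$ be its zero set. For every $\sigma$ let $\tilde{\mathcal B}_{\sigma i}$, $1\le i\le\rho_\sigma$, be Noetherian operators for $M_\sigma$, that is, operators $$\tilde{\mathcal B}_{\sigma i}(z,\partial_z)f=\sum_{|\alpha|\le A}\sum_{l=1}^{L}a^{l}_{\sigma i,\alpha}(z)\,\partial_z^\alpha f^l,\qquad a_{\sigma i,\alpha}=(a^1_{\sigma i,\alpha},\dots,a^L_{\sigma i,\alpha})\in\mathbb C[z]^L,$$ such that $f\in\mathbb C[z]^L$ belongs to $M_\sigma$ if and only if $\tilde{\mathcal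 B}_{\sigma i}(z,\partial_z)f$ vanishes on $V_{\mathfrak p_\sigma}$ for all $1\le i\le\rho_\sigma$. Let $\mathcal B_{\sigma i}(z,\partial_z)g=\sum_{|\alpha|\le A}a_{\sigma i,\alpha}(z)\,\partial_z^\alpha g\in\mathbb C^L$ be the associated vector-valued operators on scalar functions $g$. Let $\lambda\in\mathbb C$ and let $\Omega\subset\mathbb R^n$ be a nonempty open convex cone ($tx\in\Omega$ for $x\in\Omega$, $t>0$) that is pointed, i.e. $\overline\Omega\cap(-\overline\Omega)=\{0\}$. Put $\langle x,z\rangle=\sum_i x_iz_i$ and $$U_\Omega:=\{z\in\mathbb C^n:\ \langle x,\operatorname{Re}z\rangle<0\ \text{ for all }x\in\overline\Omega\setminus\{0\}\},$$ and let powers be taken in the principal branch. Define $$S_{\mathcal B,\lambda}(\Omega):=\bigl\{\Omega\ni x\mapsto\mathcal B_{\sigma i}(z,\partial_z)(-\langle x,z\rangle)^\lambda:\ 1\le\sigma\le\mu,\ 1\le i\le\rho_\sigma,\ z\in V_{\mathfrak p_\sigma}\cap U_\Omega\bigr\},$$ $$S(\Omega):=\{u\in C^\infty(\Omega)^L:\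 P(\partial_x)u=0\},\qquad H_\lambda(\Omega):=\{u\in C^\infty(\Omega):\ x\cdot\nabla u=\lambda u\}.$$ Then $$S_{\mathcal B,\lambda}(\Omega)\subset S(\Omega)\cap H_\lambda(\Omega)^L ,$$ that is, every function $x\mapsto\mathcal B_{\sigma i}(z,\partial_z)(-\langle x,z\rangle)^\lambda$ with $z\in V_{\mathfrak p_\sigma}\cap U_\Omega$ is a smooth $\lambda$-homogeneous solution of $P(\partial_x)u=0$ on $\Omega$. -/

import Mathlib

open scoped ContDiff Pointwise

noncomputable section

namespace HomogSol

/-- The `i`-th partial derivative of `f` on `𝕜ⁿ` (real partial derivatives for `𝕜 = ℝ`,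
holomorphic ones for `𝕜 = ℂ`). -/
def partialD (𝕜 : Type*) [NontriviallyNormedField 𝕜] {n : ℕ} {F : Type*} [NormedAddCommGroup F]
    [NormedSpace 𝕜 F] (i : Fin n) (f : (Fin n → 𝕜) → F) : (Fin n → 𝕜) → F :=
  fun x => fderiv 𝕜 f x (Pi.single i 1)

/-- `∂^α f = ∂₁^{α₁} ⋯ ∂ₙ^{αₙ} f` for a multi-index `α`. -/
def multiD (𝕜 : Type*) [NontriviallyNormedField 𝕜] {n : ℕ} {F : Type*} [NormedAddCommGroup F]
    [NormedSpace 𝕜 F] (α : Fin n →₀ ℕ) (f : (Fin n → 𝕜) → F) : (Fin n → 𝕜) → F :=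
  (List.finRange n).foldr (fun i g => (partialD 𝕜 i)^[α i] g) f

/-- The constant-coefficient operator `p(∂ₓ)`, acting on complex-valued functions on `ℝⁿ`. -/
def constCoeffOp {n : ℕ} (p : MvPolynomial (Fin n) ℂ) (u : (Fin n → ℝ) → ℂ) : (Fin n → ℝ) → ℂ :=
  fun x => ∑ α ∈ p.support, p.coeff α * multiD ℝ α u x

/-- The solution space `S(Ω)` of the system `P(∂ₓ) u = 0` on `Ω`. A function on `Ω` is represented
by any function on `ℝⁿ` extending it; for open `Ω` the membership depends on `u|_Ω` only. -/
def solutionSpace {n J L : ℕ} (P : Matrix (Fin J) (Fin L) (MvPolynomial (Fin n) ℂ))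
    (Ω : Set (Fin n → ℝ)) : Set ((Fin n → ℝ) → (Fin L → ℂ)) :=
  {u | ContDiffOn ℝ ∞ u Ω ∧
    ∀ j, ∀ x ∈ Ω, ∑ l, constCoeffOp (P j l) (fun y => u y l) x = 0}

/-- The Euler operator `E_λ = x · ∇ - λ`. -/
def eulerOp {n : ℕ} (lam : ℂ) (u : (Fin n → ℝ) → ℂ) : (Fin n → ℝ) → ℂ :=
  fun x => ∑ i, (x i : ℂ) * partialD ℝ i u x - lam * u x

/-- The space `H_λ(Ω)`: the kernel of `E_λ` on `C^∞(Ω)`. -/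
def homogSpace {n : ℕ} (lam : ℂ) (Ω : Set (Fin n → ℝ)) : Set ((Fin n → ℝ) → ℂ) :=
  {u | ContDiffOn ℝ ∞ u Ω ∧ ∀ x ∈ Ω, eulerOp lam u x = 0}

/-- The space `H_λ(Ω)^L`. -/
def homogSpaceVec {n : ℕ} (L : ℕ) (lam : ℂ) (Ω : Set (Fin n → ℝ)) :
    Set ((Fin n → ℝ) → (Fin L → ℂ)) :=
  {u | ∀ l, (fun x => u x l) ∈ homogSpace lam Ω}

/-- Nonempty open pointed convex cones. -/
structure IsOPC {n : ℕ} (Ω : Set (Fin n → ℝ)) : Prop where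
  nonempty : Ω.Nonempty
  isOpen : IsOpen Ω
  convex : Convex ℝ Ω
  cone : ∀ x ∈ Ω, ∀ t : ℝ, 0 < t → t • x ∈ Ω
  pointed : closure Ω ∩ -closure Ω = {0}

/-- The strict negative dual cone `X^∨`. -/
def strictNegDual {n : ℕ} (X : Set (Fin n → ℝ)) : Set (Fin n → ℝ) :=
  {η | ∀ x ∈ closure X \ {0}, ∑ i, x i * η i < 0}

/-- The tube `U_X = {z : Re z ∈ X^∨}`. -/
def tube {n : ℕ} (X : Set (Fin n → ℝ)) : Set (Fin n → ℂ) :=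
  {z | (fun i => (z i).re) ∈ strictNegDual X}

/-- The kernel `(-⟨x,z⟩)^λ` (principal branch), with `⟨x,z⟩ = ∑ᵢ xᵢ zᵢ`. -/
def kernel {n : ℕ} (lam : ℂ) (x : Fin n → ℝ) (z : Fin n → ℂ) : ℂ :=
  (-∑ i, (x i : ℂ) * z i) ^ lam

/-- The coefficients of `∑_α a_α(z) ∂_z^α` (a finite sum) with `a_α ∈ ℂ[z]^L`. -/
abbrev PolyDiffOp (n L : ℕ) : Type :=
  (Fin n →₀ ℕ) →₀ (Fin L → MvPolynomial (Fin n) ℂ)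

/-- The scalar-valued operator `f ↦ ∑_α ∑_l a_α^l(z) ∂_z^α f^l` on `ℂ^L`-valued functions. -/
def PolyDiffOp.scalarApply {n L : ℕ} (B : PolyDiffOp n L) (f : (Fin n → ℂ) → (Fin L → ℂ))
    (z : Fin n → ℂ) : ℂ :=
  ∑ α ∈ B.support, ∑ l, MvPolynomial.eval z (B α l) * multiD ℂ α (fun w => f w l) z

/-- The `ℂ^L`-valued operator `f ↦ ∑_α a_α(z) ∂_z^α f` on scalar functions. -/
def PolyDiffOp.vecApply {n L : ℕ} (B : PolyDiffOp n L) (f : (Fin n → ℂ) → ℂ)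
    (z : Fin n → ℂ) : Fin L → ℂ :=
  fun l => ∑ α ∈ B.support, MvPolynomial.eval z (B α l) * multiD ℂ α f z

/-- The submodule `P^t ℂ[z]^J` of `ℂ[z]^L`. -/
def transposeModule {n J L : ℕ} (P : Matrix (Fin J) (Fin L) (MvPolynomial (Fin n) ℂ)) :
    Submodule (MvPolynomial (Fin n) ℂ) (Fin L → MvPolynomial (Fin n) ℂ) :=
  LinearMap.range P.transpose.mulVecLin

/-- `M = ⋂_σ N σ` with every `N σ` primary. -/
structure IsPrimaryDecomposition {R E : Type*} [CommRing R] [AddCommGroup E] [Module R E] {μ : ℕ}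
    (M : Submodule R E) (N : Fin μ → Submodule R E) : Prop where
  primary : ∀ σ, (N σ).IsPrimary
  iInf_eq : M = ⨅ σ, N σ

/-- The prime ideal `√Ann(E/N)` associated with a primary submodule `N` of `E`. -/
def assocPrime {R E : Type*} [CommRing R] [AddCommGroup E] [Module R E] (N : Submodule R E) :
    Ideal R :=
  (N.colon Set.univ).radical

/-- The affine variety in `ℂⁿ` of the prime ideal associated with `N`. -/
def charVariety {n L : ℕ}
    (N : Submodule (MvPolynomial (Fin n) ℂ) (Fin L → MvPolynomial (Fin n) ℂ)) :
    Set (Fin n → ℂ) :=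
  MvPolynomial.zeroLocus ℂ (assocPrime N)

/-- `B₁, …, B_ρ` are Noetherian operators for the primary submodule `N ⊆ ℂ[z]^L` with
associated prime `𝔭`: a polynomial vector `f` lies in `N` if and only if all `B̃ᵢ(z,∂_z) f` vanish
on the variety of `𝔭`. -/
def IsNoetherianFamily {n L ρ : ℕ}
    (N : Submodule (MvPolynomial (Fin n) ℂ) (Fin L → MvPolynomial (Fin n) ℂ))
    (B : Fin ρ → PolyDiffOp n L) : Prop :=
  ∀ f : Fin L → MvPolynomial (Fin n) ℂ, f ∈ N ↔
    ∀ i, ∀ z ∈ charVariety N, (B i).scalarApply (fun w l => MvPolynomial.eval w (f l)) z = 0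

/-- The family `S_{B,λ}(Ω)` of the functions `x ↦ B_{σi}(z,∂_z) (-⟨x,z⟩)^λ` on `Ω`, with `z` in
`V_{𝔭_σ} ∩ U_Ω`. Again a function on `Ω` is represented by all its extensions to `ℝⁿ`. -/
def homogFamily {n L μ : ℕ} {ρ : Fin μ → ℕ}
    (N : Fin μ → Submodule (MvPolynomial (Fin n) ℂ) (Fin L → MvPolynomial (Fin n) ℂ))
    (B : (σ : Fin μ) → Fin (ρ σ) → PolyDiffOp n L) (lam : ℂ) (Ω : Set (Fin n → ℝ)) :
    Set ((Fin n → ℝ) → (Fin L → ℂ)) :=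
  {u | ∃ (σ : Fin μ) (i : Fin (ρ σ)), ∃ z ∈ charVariety (N σ) ∩ tube Ω,
    Set.EqOn u (fun x => (B σ i).vecApply (kernel lam x) z) Ω}

end HomogSol

end

noncomputable section

namespace HomogSol

open MvPolynomial

/-! ### Symbol calculus for functions ∑ₖ Fₖ(w) φₖ(τ(w)). -/

section Realization

variable {σ : Type*}

/-! Put τ = -⟨x,z⟩. The functions involved are finite sums ∑ₖ Fₖ(x,z) φₖ(τ) with polynomial Fₖ and
φₖ₊₁ = φₖ′. They are encoded by symbols ∑ₖ Fₖ Tᵏ, on which ∂ₛ acts as ∂ₛ + (∂ₛτ)T, so the calculus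
becomes algebra.

Since ∂τ/∂xᵢ = -zᵢ, a homogeneous p of degree m satisfies p(∂ₓ)φ₀(τ) = (-1)ᵐ p(z) φₘ(τ)
(`sum_coeff_smul_symbolMultiD_inl_one`). Derivatives in x and z commute, so applying the j-th row of
P(∂ₓ) to B(z,∂_z)φ₀(τ) gives (-1)ᵐ B̃(z,∂_z)(Pⱼ(z) φₘ(τ)). Were φₘ(τ) a polynomial in z, this would
vanish on the variety, because polynomial multiples of the row Pⱼ lie in M ⊆ `N σ`. At a fixed point
B̃ sees only a finite jet of φₘ at τ, and some polynomial has the same jet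
(`sum_realization_eq_zero`).

For homogeneity, the Euler field in x commutes with ∂_z and multiplies τ^λ by λ
(`realization_symbolEuler_symbol`). -/

theorem pderiv_pderiv_comm (s t : σ) (p : MvPolynomial σ ℂ) :
    pderiv s (pderiv t p) = pderiv t (pderiv s p) := by
  classical
  have h : ⁅(pderiv s : Derivation ℂ (MvPolynomial σ ℂ) (MvPolynomial σ ℂ)),
      (pderiv t : Derivation ℂ (MvPolynomial σ ℂ) (MvPolynomial σ ℂ))⁆ = 0 := by
    refine MvPolynomial.derivation_ext fun i => ?_
    rw [Derivation.commutator_apply, pderiv_X, pderiv_X]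
    simp only [Pi.single_apply]
    split_ifs <;> simp
  have := DFunLike.congr_fun h p
  rwa [Derivation.commutator_apply, Derivation.zero_apply, sub_eq_zero] at this

/-- A polynomial `∑ₖ Fₖ Tᵏ` over `ℂ[w]` stands for the function `w ↦ ∑ₖ Fₖ(w) φₖ(τ(w))`;
`T` thus encodes the differentiation of `φ₀ ∘ τ` if `φₖ₊₁` is the derivative of `φₖ`. -/
def realization (τ : MvPolynomial σ ℂ) (φ : ℕ → ℂ → ℂ) (w : σ → ℂ) :
    Polynomial (MvPolynomial σ ℂ) →ₗ[ℂ] ℂ :=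
  Polynomial.lsum fun k => φ k (eval w τ) • (aeval w).toLinearMap

theorem realization_monomial (τ : MvPolynomial σ ℂ) (φ : ℕ → ℂ → ℂ) (w : σ → ℂ) (k : ℕ)
    (a : MvPolynomial σ ℂ) :
    realization τ φ w (Polynomial.monomial k a) = eval w a * φ k (eval w τ) := by
  simp [realization, Polynomial.lsum_apply, Polynomial.sum_monomial_index, mul_comm,
    MvPolynomial.aeval_eq_eval]

theorem realization_C (τ : MvPolynomial σ ℂ) (φ : ℕ → ℂ → ℂ) (w : σ → ℂ)
    (a : MvPolynomial σ ℂ) :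
    realization τ φ w (Polynomial.C a) = eval w a * φ 0 (eval w τ) :=
  realization_monomial τ φ w 0 a

theorem realization_one (τ : MvPolynomial σ ℂ) (φ : ℕ → ℂ → ℂ) (w : σ → ℂ) :
    realization τ φ w 1 = φ 0 (eval w τ) := by
  simpa using realization_C τ φ w 1

theorem realization_C_mul (τ : MvPolynomial σ ℂ) (φ : ℕ → ℂ → ℂ) (w : σ → ℂ)
    (a : MvPolynomial σ ℂ) (F : Polynomial (MvPolynomial σ ℂ)) :
    realization τ φ w (Polynomial.C a * F) = eval w a * realization τ φ w F := by
  induction F using Polynomial.induction_on' with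
  | add F G hF hG => simp only [mul_add, map_add, hF, hG]
  | monomial k b =>
    rw [Polynomial.C_mul_monomial, realization_monomial, realization_monomial, map_mul, mul_assoc]

/-- A factor Tᵐ can be traded for starting the family at φₘ; this absorbs the power of T produced by
P(∂ₓ). -/
theorem realization_mul_X_pow (τ : MvPolynomial σ ℂ) (φ : ℕ → ℂ → ℂ) (w : σ → ℂ)
    (F : Polynomial (MvPolynomial σ ℂ)) (m : ℕ) :
    realization τ φ w (F * Polynomial.X ^ m) = realization τ (fun k => φ (k + m)) w F := by
  induction F using Polynomial.induction_on' with
  | add F G hF hG => simp only [add_mul, map_add, hF, hG]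
  | monomial k b =>
    rw [Polynomial.monomial_mul_X_pow, realization_monomial, realization_monomial]

/-- Only finitely many numbers φₖ(τ(w)) enter at a given point, which later permits replacing the
family by the jet of a polynomial. -/
theorem realization_congr (τ : MvPolynomial σ ℂ) {φ ψ : ℕ → ℂ → ℂ} (w : σ → ℂ)
    (F : Polynomial (MvPolynomial σ ℂ))
    (h : ∀ k ≤ F.natDegree, φ k (eval w τ) = ψ k (eval w τ)) :
    realization τ φ w F = realization τ ψ w F := by
  rw [F.as_sum_range, map_sum, map_sum]
  refine Finset.sum_congr rfl fun k hk => ?_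
  rw [realization_monomial, realization_monomial, h k (Finset.mem_range_succ_iff.1 hk)]

/-- The operator on `ℂ[w][T]` that corresponds to `∂/∂wₛ` under the realization. -/
def symbolD (τ : MvPolynomial σ ℂ) (s : σ) : Module.End ℂ (Polynomial (MvPolynomial σ ℂ)) :=
  Polynomial.lsum fun k =>
    ((Polynomial.monomial k).restrictScalars ℂ) ∘ₗ (pderiv s).toLinearMap +
      ((Polynomial.monomial (k + 1)).restrictScalars ℂ) ∘ₗ LinearMap.mulLeft ℂ (pderiv s τ)

theorem symbolD_monomial (τ : MvPolynomial σ ℂ) (s : σ) (k : ℕ) (a : MvPolynomial σ ℂ) :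
    symbolD τ s (Polynomial.monomial k a) =
      Polynomial.monomial k (pderiv s a) + Polynomial.monomial (k + 1) (pderiv s τ * a) := by
  simp [symbolD, Polynomial.lsum_apply, Polynomial.sum_monomial_index]

theorem symbolD_C_mul (τ : MvPolynomial σ ℂ) (s : σ) (a : MvPolynomial σ ℂ)
    (F : Polynomial (MvPolynomial σ ℂ)) :
    symbolD τ s (Polynomial.C a * F) =
      Polynomial.C (pderiv s a) * F + Polynomial.C a * symbolD τ s F := by
  induction F using Polynomial.induction_on' with
  | add F G hF hG => simp only [mul_add, map_add, hF, hG]; abel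
  | monomial k b =>
    simp only [Polynomial.C_mul_monomial, symbolD_monomial, mul_add, pderiv_mul, map_add,
      mul_left_comm]
    abel

theorem symbolD_mul_X_pow (τ : MvPolynomial σ ℂ) (s : σ) (F : Polynomial (MvPolynomial σ ℂ))
    (m : ℕ) :
    symbolD τ s (F * Polynomial.X ^ m) = symbolD τ s F * Polynomial.X ^ m := by
  induction F using Polynomial.induction_on' with
  | add F G hF hG => simp only [add_mul, map_add, hF, hG]
  | monomial k b =>
    simp only [Polynomial.monomial_mul_X_pow, symbolD_monomial, add_mul, add_right_comm]

theorem symbolD_one (τ : MvPolynomial σ ℂ) (s : σ) :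
    symbolD τ s 1 = Polynomial.C (pderiv s τ) * Polynomial.X := by
  rw [← Polynomial.monomial_zero_one, symbolD_monomial, pderiv_one]
  simp [Polynomial.C_mul_X_eq_monomial]

/-- Symmetry of mixed partials, applied to both the coefficients and τ, makes the cross terms in T
agree. -/
theorem symbolD_commute (τ : MvPolynomial σ ℂ) (s t : σ) :
    Commute (symbolD τ s) (symbolD τ t) := by
  refine LinearMap.ext fun F => ?_
  simp only [Module.End.mul_apply]
  induction F using Polynomial.induction_on' with
  | add F G hF hG => simp only [map_add, hF, hG]
  | monomial k b =>
    simp only [symbolD_monomial, map_add, pderiv_mul, pderiv_pderiv_comm s t,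
      mul_left_comm (pderiv s τ)]
    rw [mul_comm (pderiv t τ) (pderiv s b), mul_comm (pderiv s τ) (pderiv t b)]
    rw [mul_comm (pderiv t b), mul_comm (pderiv s b)]
    abel

/-- The iterated operator that corresponds to `∂^α` in the variables selected by `v`. -/
def symbolMultiD {n : ℕ} (τ : MvPolynomial σ ℂ) (v : Fin n → σ) (α : Fin n →₀ ℕ) :
    Module.End ℂ (Polynomial (MvPolynomial σ ℂ)) :=
  ((List.finRange n).map fun i => symbolD τ (v i) ^ α i).prod

theorem symbolMultiD_commute {n : ℕ} (τ : MvPolynomial σ ℂ) (v : Fin n → σ) (α : Fin n →₀ ℕ)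
    {T : Module.End ℂ (Polynomial (MvPolynomial σ ℂ))} (h : ∀ i, Commute T (symbolD τ (v i))) :
    Commute T (symbolMultiD τ v α) := by
  refine Commute.list_prod_right _ _ fun S hS => ?_
  obtain ⟨i, -, rfl⟩ := List.mem_map.1 hS
  exact (h i).pow_right _

theorem symbolMultiD_mul_X_pow {n : ℕ} (τ : MvPolynomial σ ℂ) (v : Fin n → σ) (α : Fin n →₀ ℕ)
    (F : Polynomial (MvPolynomial σ ℂ)) (m : ℕ) :
    symbolMultiD τ v α (F * Polynomial.X ^ m) = symbolMultiD τ v α F * Polynomial.X ^ m := by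
  have h := symbolMultiD_commute τ v α (T := LinearMap.mulRight ℂ (Polynomial.X ^ m))
    fun i => LinearMap.ext fun F => (symbolD_mul_X_pow τ (v i) F m).symm
  exact (LinearMap.congr_fun h F).symm

variable [Fintype σ]

theorem hasFDerivAt_eval (p : MvPolynomial σ ℂ) (w : σ → ℂ) :
    HasFDerivAt (fun w => eval w p)
      (∑ s, eval w (pderiv s p) • ContinuousLinearMap.proj (R := ℂ) (φ := fun _ : σ => ℂ) s) w := by
  classical
  induction p using MvPolynomial.induction_on with
  | C a =>
    simp only [eval_C]
    refine (hasFDerivAt_const (𝕜 := ℂ) a w).congr_fderiv ?_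
    ext v
    simp
  | add p q hp hq =>
    simp only [map_add]
    refine (hp.fun_add hq).congr_fderiv ?_
    ext v
    simp [add_mul, Finset.sum_add_distrib]
  | mul_X p i hp =>
    have hX : HasFDerivAt (fun w : σ → ℂ => w i)
      (ContinuousLinearMap.proj (R := ℂ) (φ := fun _ : σ => ℂ) i) w := hasFDerivAt_apply i w
    simp only [map_mul, eval_X]
    refine (hp.mul hX).congr_fderiv ?_
    ext v
    have hs (s : σ) : eval w (pderiv s (p * X i)) * v s =
        w i * (eval w (pderiv s p) * v s) + if s = i then eval w p * v s else 0 := by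
      rw [pderiv_mul, pderiv_X, Pi.single_apply]
      split_ifs with h₁ h₂ h₂
      · simp; ring
      · exact absurd h₁.symm h₂
      · exact absurd h₂.symm h₁
      · simp; ring
    simp only [add_apply, smul_apply, sum_apply, ContinuousLinearMap.proj_apply, smul_eq_mul, hs,
      Finset.sum_add_distrib, Finset.mul_sum, Finset.sum_ite_eq', Finset.mem_univ, if_true]
    rw [add_comm]

/-- Product and chain rule: differentiating φₖ(τ) gives (∂ₛτ) φₖ₊₁(τ), the degree-raising term of
`symbolD`. -/
theorem hasFDerivAt_realization (τ : MvPolynomial σ ℂ) {φ : ℕ → ℂ → ℂ} {w : σ → ℂ}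
    (hφ : ∀ k, HasDerivAt (φ k) (φ (k + 1) (eval w τ)) (eval w τ))
    (F : Polynomial (MvPolynomial σ ℂ)) :
    HasFDerivAt (fun w => realization τ φ w F)
      (∑ s, realization τ φ w (symbolD τ s F) •
        ContinuousLinearMap.proj (R := ℂ) (φ := fun _ : σ => ℂ) s) w := by
  induction F using Polynomial.induction_on' with
  | add F G hF hG =>
    simp only [map_add]
    refine (hF.fun_add hG).congr_fderiv ?_
    ext v
    simp [add_mul, Finset.sum_add_distrib]
  | monomial k b =>
    simp only [realization_monomial, symbolD_monomial, map_add, map_mul]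
    refine ((hasFDerivAt_eval b w).mul
      ((hφ k).comp_hasFDerivAt w (hasFDerivAt_eval τ w))).congr_fderiv ?_
    ext v
    simp only [add_apply, smul_apply, sum_apply,
      ContinuousLinearMap.proj_apply, smul_eq_mul, Finset.mul_sum, ← Finset.sum_add_distrib,
      Function.comp_apply]
    exact Finset.sum_congr rfl fun s _ => by ring

theorem contDiffOn_realization (τ : MvPolynomial σ ℂ) {φ : ℕ → ℂ → ℂ} {S : Set ℂ}
    (hφ : ∀ k, ContDiffOn ℂ ∞ (φ k) S) (F : Polynomial (MvPolynomial σ ℂ)) :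
    ContDiffOn ℂ ∞ (fun w => realization τ φ w F) {w | eval w τ ∈ S} := by
  have he (p : MvPolynomial σ ℂ) : ContDiff ℂ ∞ fun w : σ → ℂ => eval w p :=
    (AnalyticOnNhd.eval_mvPolynomial p).contDiff
  induction F using Polynomial.induction_on' with
  | add F G hF hG => simpa only [map_add] using hF.add hG
  | monomial k b =>
    simp only [realization_monomial]
    exact (he b).contDiffOn.mul ((hφ k).comp (he τ).contDiffOn fun w hw => hw)

end Realization

/-! ### Iterated partial derivatives through symbols, over ℝ and ℂ at once. -/

section MultiD

variable {n : ℕ} {σ : Type*} [Fintype σ] {𝕜 : Type*} [NontriviallyNormedField 𝕜]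
  [NormedAlgebra 𝕜 ℂ]

/-- Along a map `ι` whose `i`-th partial derivative is the unit vector of the variable `v i`, the
partial derivatives of a realization are given by the symbolic operators. -/
theorem partialD_eqOn_realization [DecidableEq σ] (τ : MvPolynomial σ ℂ) {φ : ℕ → ℂ → ℂ}
    {O : Set (Fin n → 𝕜)} (hO : IsOpen O) {ι : (Fin n → 𝕜) → σ → ℂ}
    {ι' : (Fin n → 𝕜) →L[𝕜] σ → ℂ} (hι : ∀ x, HasFDerivAt ι ι' x) (v : Fin n → σ)
    (hv : ∀ i, ι' (Pi.single i 1) = Pi.single (v i) 1)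
    (hφ : ∀ x ∈ O, ∀ k, HasDerivAt (φ k) (φ (k + 1) (eval (ι x) τ)) (eval (ι x) τ))
    {f : (Fin n → 𝕜) → ℂ} {F : Polynomial (MvPolynomial σ ℂ)}
    (hf : Set.EqOn f (fun x => realization τ φ (ι x) F) O) (i : Fin n) :
    Set.EqOn (partialD 𝕜 i f) (fun x => realization τ φ (ι x) (symbolD τ (v i) F)) O := by
  intro x hx
  have h := (((hasFDerivAt_realization τ (hφ x hx) F).restrictScalars 𝕜).comp x
    (hι x)).congr_of_eventuallyEq (hf.eventuallyEq_of_mem (hO.mem_nhds hx))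
  rw [partialD, h.fderiv]
  simp [hv, Pi.single_apply]

theorem multiD_eqOn_realization [DecidableEq σ] (τ : MvPolynomial σ ℂ) {φ : ℕ → ℂ → ℂ}
    {O : Set (Fin n → 𝕜)} (hO : IsOpen O) {ι : (Fin n → 𝕜) → σ → ℂ}
    {ι' : (Fin n → 𝕜) →L[𝕜] σ → ℂ} (hι : ∀ x, HasFDerivAt ι ι' x) (v : Fin n → σ)
    (hv : ∀ i, ι' (Pi.single i 1) = Pi.single (v i) 1)
    (hφ : ∀ x ∈ O, ∀ k, HasDerivAt (φ k) (φ (k + 1) (eval (ι x) τ)) (eval (ι x) τ))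
    {f : (Fin n → 𝕜) → ℂ} {F : Polynomial (MvPolynomial σ ℂ)}
    (hf : Set.EqOn f (fun x => realization τ φ (ι x) F) O) (α : Fin n →₀ ℕ) :
    Set.EqOn (multiD 𝕜 α f) (fun x => realization τ φ (ι x) (symbolMultiD τ v α F)) O := by
  have iter (i : Fin n) (k : ℕ) {g : (Fin n → 𝕜) → ℂ} {G : Polynomial (MvPolynomial σ ℂ)}
      (hg : Set.EqOn g (fun x => realization τ φ (ι x) G) O) :
      Set.EqOn ((partialD 𝕜 i)^[k] g)
        (fun x => realization τ φ (ι x) ((symbolD τ (v i) ^ k) G)) O := by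
    induction k with
    | zero => simpa using hg
    | succ k ih =>
      rw [Function.iterate_succ_apply', pow_succ']
      exact partialD_eqOn_realization τ hO hι v hv hφ ih i
  unfold multiD symbolMultiD
  induction List.finRange n with
  | nil => simpa using hf
  | cons i l ih =>
    rw [List.foldr_cons, List.map_cons, List.prod_cons]
    exact iter i (α i) ih

end MultiD

/-! ### Derivatives of the complex power and interpolation of jets. -/

section PowerFamily

/-- The successive derivatives `λ(λ-1)⋯(λ-k+1) t^(λ-k)` of `t^λ`. -/
def powDeriv (lam : ℂ) (k : ℕ) (t : ℂ) : ℂ :=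
  (descPochhammer ℂ k).eval lam * t ^ (lam - k)

theorem powDeriv_zero (lam t : ℂ) : powDeriv lam 0 t = t ^ lam := by
  simp [powDeriv]

theorem hasDerivAt_powDeriv (lam : ℂ) (k : ℕ) {t : ℂ} (ht : 0 < t.re) :
    HasDerivAt (powDeriv lam k) (powDeriv lam (k + 1) t) t := by
  have h := ((hasDerivAt_id t).cpow_const (c := lam - k) (Or.inl ht)).const_mul
    ((descPochhammer ℂ k).eval lam)
  refine h.congr_deriv ?_
  rw [powDeriv, descPochhammer_succ_right]
  simp only [id, Polynomial.eval_mul, Polynomial.eval_sub, Polynomial.eval_X,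
    Polynomial.eval_natCast, Nat.cast_add, Nat.cast_one, sub_sub, mul_one, mul_assoc]

theorem contDiffOn_powDeriv (lam : ℂ) (k : ℕ) : ContDiffOn ℂ ∞ (powDeriv lam k) {t | 0 < t.re} :=
  DifferentiableOn.contDiffOn
    (fun _ ht => (hasDerivAt_powDeriv lam k ht).differentiableAt.differentiableWithinAt)
    (isOpen_lt continuous_const Complex.continuous_re)

theorem mul_powDeriv_one (lam : ℂ) {t : ℂ} (ht : t ≠ 0) :
    t * powDeriv lam 1 t = lam * powDeriv lam 0 t := by
  simp only [powDeriv, descPochhammer_one, descPochhammer_zero, Polynomial.eval_X,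
    Polynomial.eval_one, Nat.cast_one, Nat.cast_zero, sub_zero, one_mul]
  rw [Complex.cpow_sub _ _ ht, Complex.cpow_one]
  field_simp

/-- A polynomial can be chosen to have any prescribed finite jet at a point. -/
theorem exists_polynomial_iterate_derivative_eq (c : ℕ → ℂ) (t : ℂ) (d : ℕ) :
    ∃ Q : Polynomial ℂ, ∀ k ≤ d, (Polynomial.derivative^[k] Q).eval t = c k := by
  let S : Polynomial ℂ := ∑ k ∈ Finset.range (d + 1), Polynomial.monomial k (c k / k.factorial)
  -- Shifting by -t turns `S` into the Taylor polynomial S(X - t) centred at t.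
  refine ⟨Polynomial.taylor (-t) S, fun k hk => ?_⟩
  have h : (Polynomial.hasseDeriv k (Polynomial.taylor (-t) S)).eval t = c k / k.factorial := by
    rw [← Polynomial.taylor_coeff, Polynomial.taylor_taylor, add_neg_cancel,
      Polynomial.taylor_zero]
    simp [S, Polynomial.finsetSum_coeff, Polynomial.coeff_monomial, hk]
  rw [← Polynomial.factorial_smul_hasseDeriv, LinearMap.smul_apply, Polynomial.eval_smul, h,
    nsmul_eq_mul]
  exact mul_div_cancel₀ _ (Nat.cast_ne_zero.2 k.factorial_ne_zero)

end PowerFamily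

/-! ### The phase -⟨x,z⟩ and operators in x and z. -/

section Pairing

variable {n : ℕ}

/-- The polynomial `-⟨x,z⟩` in the variables `x` (left) and `z` (right). -/
def negPairing (n : ℕ) : MvPolynomial (Fin n ⊕ Fin n) ℂ :=
  -∑ i, X (Sum.inl i) * X (Sum.inr i)

/-- The point `(x,z)` of `ℂⁿ × ℂⁿ`. -/
def pairPoint (x : Fin n → ℝ) (z : Fin n → ℂ) : Fin n ⊕ Fin n → ℂ :=
  Sum.elim (fun i => (x i : ℂ)) z

theorem eval_negPairing (x : Fin n → ℝ) (z : Fin n → ℂ) :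
    eval (pairPoint x z) (negPairing n) = -∑ i, (x i : ℂ) * z i := by
  simp [negPairing, pairPoint]

theorem pderiv_inl_negPairing (i : Fin n) :
    pderiv (Sum.inl i) (negPairing n) = -X (Sum.inr i) := by
  simp [negPairing, pderiv_X, Pi.single_apply]

theorem hasFDerivAt_pairPoint_left (x : Fin n → ℝ) (z : Fin n → ℂ) :
    HasFDerivAt (fun y => pairPoint y z)
      (ContinuousLinearMap.pi (Sum.elim
        (fun i => Complex.ofRealCLM.comp (ContinuousLinearMap.proj i)) fun _ => 0)) x := by
  refine hasFDerivAt_pi.2 fun s => ?_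
  rcases s with i | i
  · exact Complex.ofRealCLM.hasFDerivAt.comp x (hasFDerivAt_apply i x)
  · exact hasFDerivAt_const (z i) x

theorem hasFDerivAt_pairPoint_right (x : Fin n → ℝ) (z : Fin n → ℂ) :
    HasFDerivAt (fun w => pairPoint x w)
      (ContinuousLinearMap.pi (Sum.elim (fun _ => 0) fun i => ContinuousLinearMap.proj i) :
        (Fin n → ℂ) →L[ℂ] Fin n ⊕ Fin n → ℂ) z := by
  refine hasFDerivAt_pi.2 fun s => ?_
  rcases s with i | i
  · exact hasFDerivAt_const (x i : ℂ) z
  · exact hasFDerivAt_apply i z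

theorem contDiff_pairPoint_left (z : Fin n → ℂ) : ContDiff ℝ ∞ fun y => pairPoint y z := by
  refine contDiff_pi.2 fun s => ?_
  rcases s with i | i
  · exact Complex.ofRealCLM.contDiff.comp (contDiff_apply ℝ ℝ i)
  · exact contDiff_const

variable {φ : ℕ → ℂ → ℂ} {F : Polynomial (MvPolynomial (Fin n ⊕ Fin n) ℂ)}

theorem multiD_eqOn_realization_left {z : Fin n → ℂ} {O : Set (Fin n → ℝ)} (hO : IsOpen O)
    (hφ : ∀ x ∈ O, ∀ k, HasDerivAt (φ k) (φ (k + 1) (eval (pairPoint x z) (negPairing n)))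
      (eval (pairPoint x z) (negPairing n))) {f : (Fin n → ℝ) → ℂ}
    (hf : Set.EqOn f (fun x => realization (negPairing n) φ (pairPoint x z) F) O)
    (α : Fin n →₀ ℕ) :
    Set.EqOn (multiD ℝ α f) (fun x => realization (negPairing n) φ (pairPoint x z)
      (symbolMultiD (negPairing n) Sum.inl α F)) O := by
  refine multiD_eqOn_realization _ hO (fun x => hasFDerivAt_pairPoint_left x z) _ (fun i => ?_)
    hφ hf α
  ext s
  rcases s with j | j
  · by_cases h : j = i <;> simp [h]
  · simp

theorem partialD_eqOn_realization_left {z : Fin n → ℂ} {O : Set (Fin n → ℝ)} (hO : IsOpen O)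
    (hφ : ∀ x ∈ O, ∀ k, HasDerivAt (φ k) (φ (k + 1) (eval (pairPoint x z) (negPairing n)))
      (eval (pairPoint x z) (negPairing n))) {f : (Fin n → ℝ) → ℂ}
    (hf : Set.EqOn f (fun x => realization (negPairing n) φ (pairPoint x z) F) O) (i : Fin n) :
    Set.EqOn (partialD ℝ i f) (fun x => realization (negPairing n) φ (pairPoint x z)
      (symbolD (negPairing n) (Sum.inl i) F)) O := by
  refine partialD_eqOn_realization _ hO (fun x => hasFDerivAt_pairPoint_left x z) _ (fun i => ?_)
    hφ hf i
  ext s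
  rcases s with j | j
  · by_cases h : j = i <;> simp [h]
  · simp

theorem multiD_eqOn_realization_right {x : Fin n → ℝ} {O : Set (Fin n → ℂ)} (hO : IsOpen O)
    (hφ : ∀ w ∈ O, ∀ k, HasDerivAt (φ k) (φ (k + 1) (eval (pairPoint x w) (negPairing n)))
      (eval (pairPoint x w) (negPairing n))) {f : (Fin n → ℂ) → ℂ}
    (hf : Set.EqOn f (fun w => realization (negPairing n) φ (pairPoint x w) F) O)
    (α : Fin n →₀ ℕ) :
    Set.EqOn (multiD ℂ α f) (fun w => realization (negPairing n) φ (pairPoint x w)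
      (symbolMultiD (negPairing n) Sum.inr α F)) O := by
  refine multiD_eqOn_realization _ hO (fun w => hasFDerivAt_pairPoint_right x w) _ (fun i => ?_)
    hφ hf α
  ext s
  rcases s with j | j <;> simp [Pi.single_apply]

theorem symbolMultiD_inl_inr_commute (α β : Fin n →₀ ℕ) :
    Commute (symbolMultiD (negPairing n) Sum.inl β) (symbolMultiD (negPairing n) Sum.inr α) :=
  symbolMultiD_commute _ _ _ fun _ =>
    (symbolMultiD_commute _ _ _ fun _ => symbolD_commute _ _ _).symm

/-- The symbol of the Euler field `∑ᵢ xᵢ ∂/∂xᵢ`. -/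
def symbolEuler (n : ℕ) : Module.End ℂ (Polynomial (MvPolynomial (Fin n ⊕ Fin n) ℂ)) :=
  ∑ i, LinearMap.mulLeft ℂ (Polynomial.C (X (Sum.inl i))) * symbolD (negPairing n) (Sum.inl i)

theorem realization_symbolEuler (x : Fin n → ℝ) (z : Fin n → ℂ) :
    realization (negPairing n) φ (pairPoint x z) (symbolEuler n F) =
      ∑ i, (x i : ℂ) * realization (negPairing n) φ (pairPoint x z)
        (symbolD (negPairing n) (Sum.inl i) F) := by
  simp [symbolEuler, LinearMap.sum_apply, realization_C_mul, pairPoint]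

theorem symbolEuler_one : symbolEuler n 1 = Polynomial.C (negPairing n) * Polynomial.X := by
  simp only [symbolEuler, LinearMap.sum_apply, Module.End.mul_apply, LinearMap.mulLeft_apply,
    symbolD_one, pderiv_inl_negPairing, ← mul_assoc, ← map_mul]
  rw [← Finset.sum_mul, ← map_sum]
  simp [negPairing]

/-- The coefficients xᵢ of the Euler field are constant in z, so the product rule adds no extra
term. -/
theorem symbolEuler_commute (α : Fin n →₀ ℕ) :
    Commute (symbolEuler n) (symbolMultiD (negPairing n) Sum.inr α) := by
  refine symbolMultiD_commute _ _ _ fun j => Commute.sum_left _ _ _ fun i _ => ?_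
  refine Commute.mul_left (LinearMap.ext fun F => ?_) (symbolD_commute _ _ _)
  simp [symbolD_C_mul]

/-- Each ∂/∂xᵢ contributes a factor -zᵢT; the coefficients already produced involve z only, so they
are not differentiated further. -/
theorem symbolMultiD_inl_one (β : Fin n →₀ ℕ) :
    symbolMultiD (negPairing n) Sum.inl β 1 =
      Polynomial.C (rename Sum.inr (monomial β (1 : ℂ))) * (-Polynomial.X) ^ β.degree := by
  have step (i : Fin n) (p : MvPolynomial (Fin n) ℂ) (d : ℕ) (k : ℕ) :
      (symbolD (negPairing n) (Sum.inl i) ^ k)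
          (Polynomial.C (rename Sum.inr p) * (-Polynomial.X) ^ d) =
        Polynomial.C (rename Sum.inr (X i ^ k * p)) * (-Polynomial.X) ^ (k + d) := by
    induction k with
    | zero => simp
    | succ k ih =>
      have h0 : pderiv (Sum.inl i) (rename Sum.inr (X i ^ k * p) :
          MvPolynomial (Fin n ⊕ Fin n) ℂ) = 0 := by
        refine pderiv_eq_zero_of_notMem_vars fun h => ?_
        classical
        obtain ⟨j, -, hj⟩ := Finset.mem_image.1 (vars_rename _ _ h)
        exact Sum.inr_ne_inl hj
      have h1 : ((-Polynomial.X) ^ (k + d) : Polynomial (MvPolynomial (Fin n ⊕ Fin n) ℂ)) =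
          Polynomial.C ((-1) ^ (k + d)) * (1 * Polynomial.X ^ (k + d)) := by
        rw [map_pow, map_neg, map_one, one_mul]
        exact neg_pow (Polynomial.X : Polynomial (MvPolynomial (Fin n ⊕ Fin n) ℂ)) (k + d)
      rw [pow_succ', Module.End.mul_apply, ih, symbolD_C_mul, h0, h1, symbolD_C_mul,
        symbolD_mul_X_pow, symbolD_one, pderiv_inl_negPairing, add_right_comm k 1 d, pow_succ',
        pow_succ', h1]
      simp
      ring
  have key (l : List (Fin n)) :
      (l.map fun i => symbolD (negPairing n) (Sum.inl i) ^ β i).prod 1 =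
        Polynomial.C (rename Sum.inr (l.map fun i => X i ^ β i : List (MvPolynomial (Fin n) ℂ)).prod)
          * (-Polynomial.X) ^ (l.map β).sum := by
    induction l with
    | nil => simp
    | cons i l ih =>
      rw [List.map_cons, List.prod_cons, Module.End.mul_apply, ih, step]
      simp
  rw [symbolMultiD, key, MvPolynomial.monomial_eq, Finsupp.prod_fintype _ _ (fun _ => pow_zero _),
    Finsupp.degree_eq_sum, ← List.prod_ofFn, ← List.sum_ofFn, List.ofFn_eq_map, List.ofFn_eq_map]
  simp

end Pairing

/-! ### Positivity on the tube, symbols of the kernel family, and the Noetherian condition. -/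

section Family

variable {n L : ℕ}

/-- An open cone containing 0 is the whole space, which is not pointed once n ≥ 1. For n = 0 the set
{0} would be a counterexample. -/
theorem IsOPC.zero_notMem {Ω : Set (Fin n → ℝ)} (hΩ : IsOPC Ω) (hn : 1 ≤ n) :
    (0 : Fin n → ℝ) ∉ Ω := by
  intro h0
  have : Nonempty (Fin n) := ⟨⟨0, hn⟩⟩
  have hall (y : Fin n → ℝ) : y ∈ Ω := by
    have hc : Filter.Tendsto (fun t : ℝ => t • y) (nhds 0) (nhds 0) := by
      have : Continuous fun t : ℝ => t • y := by fun_prop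
      simpa using this.tendsto 0
    have hev := (hc.eventually (hΩ.isOpen.mem_nhds h0)).filter_mono
      (nhdsWithin_le_nhds (s := Set.Ioi 0))
    obtain ⟨t, hty, ht⟩ := (hev.and self_mem_nhdsWithin).exists
    have ht : 0 < t := ht
    simpa [smul_smul, inv_mul_cancel₀ ht.ne'] using hΩ.cone _ hty t⁻¹ (inv_pos.2 ht)
  have h1 : (1 : Fin n → ℝ) ∈ closure Ω ∩ -closure Ω :=
    ⟨subset_closure (hall _), Set.mem_neg.2 (subset_closure (hall _))⟩
  rw [hΩ.pointed] at h1
  exact one_ne_zero h1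

theorem IsOPC.re_negPairing_pos {Ω : Set (Fin n → ℝ)} (hΩ : IsOPC Ω) (hn : 1 ≤ n)
    {x : Fin n → ℝ} (hx : x ∈ Ω) {z : Fin n → ℂ} (hz : z ∈ tube Ω) :
    0 < (eval (pairPoint x z) (negPairing n)).re := by
  have h := hz x ⟨subset_closure hx, fun h => hΩ.zero_notMem hn (h ▸ hx)⟩
  rw [eval_negPairing]
  simpa [Complex.re_sum] using h

theorem isOpen_re_negPairing_pos (x : Fin n → ℝ) :
    IsOpen {w : Fin n → ℂ | 0 < (eval (pairPoint x w) (negPairing n)).re} := by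
  simp only [eval_negPairing]
  exact isOpen_lt continuous_const (by fun_prop)

theorem kernel_eq_realization (lam : ℂ) (x : Fin n → ℝ) (z : Fin n → ℂ) :
    kernel lam x z = realization (negPairing n) (powDeriv lam) (pairPoint x z) 1 := by
  rw [realization_one, powDeriv_zero, eval_negPairing, kernel]

theorem multiD_kernel (lam : ℂ) {x : Fin n → ℝ} {z : Fin n → ℂ}
    (h : 0 < (eval (pairPoint x z) (negPairing n)).re) (α : Fin n →₀ ℕ) :
    multiD ℂ α (kernel lam x) z = realization (negPairing n) (powDeriv lam) (pairPoint x z)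
      (symbolMultiD (negPairing n) Sum.inr α 1) :=
  multiD_eqOn_realization_right (isOpen_re_negPairing_pos x)
    (fun _ hw k => hasDerivAt_powDeriv lam k hw) (fun w _ => kernel_eq_realization lam x w) α h

/-- The `l`-th component of the symbol of `x ↦ B(z,∂_z)(-⟨x,z⟩)^λ`. -/
def PolyDiffOp.symbol (B : PolyDiffOp n L) (z : Fin n → ℂ) (l : Fin L) :
    Polynomial (MvPolynomial (Fin n ⊕ Fin n) ℂ) :=
  ∑ α ∈ B.support, eval z (B α l) • symbolMultiD (negPairing n) Sum.inr α 1

theorem vecApply_kernel (B : PolyDiffOp n L) (lam : ℂ) {x : Fin n → ℝ} {z : Fin n → ℂ}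
    (h : 0 < (eval (pairPoint x z) (negPairing n)).re) (l : Fin L) :
    B.vecApply (kernel lam x) z l =
      realization (negPairing n) (powDeriv lam) (pairPoint x z) (B.symbol z l) := by
  simp only [PolyDiffOp.vecApply, PolyDiffOp.symbol, map_sum, map_smul, smul_eq_mul,
    multiD_kernel lam h]

theorem realization_symbolEuler_symbol (B : PolyDiffOp n L) (lam : ℂ) {x : Fin n → ℝ}
    {z : Fin n → ℂ} (h : 0 < (eval (pairPoint x z) (negPairing n)).re) (l : Fin L) :
    realization (negPairing n) (powDeriv lam) (pairPoint x z) (symbolEuler n (B.symbol z l)) =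
      lam * realization (negPairing n) (powDeriv lam) (pairPoint x z) (B.symbol z l) := by
  have key (α : Fin n →₀ ℕ) : realization (negPairing n) (powDeriv lam) (pairPoint x z)
      (symbolEuler n (symbolMultiD (negPairing n) Sum.inr α 1)) =
      lam * realization (negPairing n) (powDeriv lam) (pairPoint x z)
        (symbolMultiD (negPairing n) Sum.inr α 1) := by
    have hc : symbolEuler n (symbolMultiD (negPairing n) Sum.inr α 1) =
        symbolMultiD (negPairing n) Sum.inr α (symbolEuler n 1) :=
      LinearMap.congr_fun (symbolEuler_commute α) 1
    -- The relation τ φ₁(τ) = λ φ₀(τ) is special to powers and fails for symbols. It holds for the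
    -- realized functions on an open set of w, so it may be differentiated in z: `h₁` and `h₂`
    -- compute the same derivative from two symbols.
    have hE : Set.EqOn
        (fun w => realization (negPairing n) (powDeriv lam) (pairPoint x w) (lam • 1))
        (fun w => realization (negPairing n) (powDeriv lam) (pairPoint x w) (symbolEuler n 1))
        {w | 0 < (eval (pairPoint x w) (negPairing n)).re} := by
      intro w hw
      have hw0 : eval (pairPoint x w) (negPairing n) ≠ 0 := by
        intro h0
        simp [h0] at hw
      simp only [map_smul, smul_eq_mul, symbolEuler_one, realization_one,
        Polynomial.C_mul_X_eq_monomial, realization_monomial]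
      exact (mul_powDeriv_one lam hw0).symm
    have h₁ := multiD_eqOn_realization_right (isOpen_re_negPairing_pos x)
      (fun _ hw k => hasDerivAt_powDeriv lam k hw) hE α h
    have h₂ := multiD_eqOn_realization_right (isOpen_re_negPairing_pos x)
      (fun _ hw k => hasDerivAt_powDeriv lam k hw) (Set.eqOn_refl
        (fun w => realization (negPairing n) (powDeriv lam) (pairPoint x w) (lam • 1)) _) α h
    rw [hc]
    refine (h₁.symm.trans h₂).trans ?_
    simp only [map_smul, smul_eq_mul]
  simp only [PolyDiffOp.symbol, map_sum, map_smul, smul_eq_mul, key, Finset.mul_sum,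
    mul_left_comm lam]

/-- A homogeneous `p(∂ₓ)` acts on the symbol `1` of the kernel as multiplication by `p(z)(-T)ᵐ`. -/
theorem sum_coeff_smul_symbolMultiD_inl_one {m : ℕ} {p : MvPolynomial (Fin n) ℂ}
    (hp : p.IsHomogeneous m) :
    ∑ β ∈ p.support, p.coeff β • symbolMultiD (negPairing n) Sum.inl β 1 =
      (-1 : ℂ) ^ m • (Polynomial.C (rename Sum.inr p) * Polynomial.X ^ m) := by
  have h (β) (hβ : β ∈ p.support) : p.coeff β • symbolMultiD (negPairing n) Sum.inl β 1 =
      Polynomial.C (rename Sum.inr (monomial β (p.coeff β))) * (-Polynomial.X) ^ m := by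
    have hd : β.degree = m := by
      rw [Finsupp.degree_eq_weight_one]
      exact hp (mem_support_iff.1 hβ)
    have hm : monomial β (p.coeff β) = p.coeff β • monomial β (1 : ℂ) := by
      rw [smul_monomial, smul_eq_mul, mul_one]
    rw [symbolMultiD_inl_one, hd, hm, map_smul, ← Polynomial.smul_C, smul_mul_assoc]
  rw [Finset.sum_congr rfl h, ← Finset.sum_mul, ← map_sum, ← map_sum, ← p.as_sum]
  rcases Nat.even_or_odd m with hm | hm
  · rw [hm.neg_one_pow, one_smul]
    exact congrArg _ (hm.neg_pow (Polynomial.X : Polynomial (MvPolynomial (Fin n ⊕ Fin n) ℂ)))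
  · rw [hm.neg_one_pow, neg_one_smul]
    exact (congrArg _
      (hm.neg_pow (Polynomial.X : Polynomial (MvPolynomial (Fin n ⊕ Fin n) ℂ)))).trans (mul_neg _ _)

/-- A Noetherian condition for all polynomial multiples of a polynomial vector `p` persists if
the polynomial factor is replaced by a function of `-⟨x,z⟩`. -/
theorem sum_realization_eq_zero (B : PolyDiffOp n L) (p : Fin L → MvPolynomial (Fin n) ℂ)
    (z : Fin n → ℂ)
    (hB : ∀ q : MvPolynomial (Fin n) ℂ,
      B.scalarApply (fun w l => eval w ((q • p) l)) z = 0)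
    (ψ : ℕ → ℂ → ℂ) (x : Fin n → ℝ) :
    realization (negPairing n) ψ (pairPoint x z) (∑ l, ∑ α ∈ B.support, eval z (B α l) •
      symbolMultiD (negPairing n) Sum.inr α (Polynomial.C (rename Sum.inr (p l)))) = 0 := by
  set H := ∑ l, ∑ α ∈ B.support, eval z (B α l) •
      symbolMultiD (negPairing n) Sum.inr α (Polynomial.C (rename Sum.inr (p l))) with hH
  -- Matching up to the T-degree of `H` suffices. No relation among the ψₖ is needed, since only
  -- their values at this one point are used.
  obtain ⟨Q, hQ⟩ := exists_polynomial_iterate_derivative_eq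
    (fun k => ψ k (eval (pairPoint x z) (negPairing n)))
    (eval (pairPoint x z) (negPairing n)) H.natDegree
  let χ : ℕ → ℂ → ℂ := fun k t => (Polynomial.derivative^[k] Q).eval t
  rw [realization_congr (ψ := χ) _ _ _ fun k hk => (hQ k hk).symm]
  have hχ (t : ℂ) (k : ℕ) : HasDerivAt (χ k) (χ (k + 1) t) t := by
    simp only [χ, Function.iterate_succ_apply']
    exact Polynomial.hasDerivAt _ t
  -- With x frozen, Q(-⟨x,·⟩) is a polynomial in z, hence an admissible multiplier in `hB`.
  let q : MvPolynomial (Fin n) ℂ :=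
    Polynomial.aeval (-∑ i, C (x i : ℂ) * X i : MvPolynomial (Fin n) ℂ) Q
  have hq (l : Fin L) : Set.EqOn (fun w => eval w ((q • p) l))
      (fun w => realization (negPairing n) χ (pairPoint x w)
        (Polynomial.C (rename Sum.inr (p l)))) Set.univ := by
    intro w _
    have h1 : eval w q = Q.eval (eval (pairPoint x w) (negPairing n)) := by
      rw [eval_negPairing]
      have := Polynomial.aeval_algHom_apply (aeval w : MvPolynomial (Fin n) ℂ →ₐ[ℂ] ℂ)
        (-∑ i, C (x i : ℂ) * X i) Q
      rw [aeval_eq_eval] at this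
      refine Eq.trans this.symm ?_
      simp [Polynomial.aeval_def, Polynomial.eval₂_eq_eval_map]
    have h2 : eval (pairPoint x w) (rename Sum.inr (p l)) = eval w (p l) := by
      rw [eval_rename]
      rfl
    simp only [realization_C, Pi.smul_apply, smul_eq_mul, map_mul, h1, h2, χ,
      Function.iterate_zero, id, mul_comm]
  have h := hB q
  rw [PolyDiffOp.scalarApply, Finset.sum_comm] at h
  rw [hH, ← h]
  simp only [map_sum, map_smul, smul_eq_mul]
  refine Finset.sum_congr rfl fun l _ => Finset.sum_congr rfl fun α _ => ?_
  rw [multiD_eqOn_realization_right isOpen_univ (fun w _ k => hχ _ k) (hq l) α (Set.mem_univ z)]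

end Family

end HomogSol

end

/-! ### The inclusion itself. -/

theorem proposition3p4 {n J L m μ : ℕ} (hn : 1 ≤ n)
    (P : Matrix (Fin J) (Fin L) (MvPolynomial (Fin n) ℂ))
    (hP : ∀ j l, (P j l).IsHomogeneous m)
    (N : Fin μ → Submodule (MvPolynomial (Fin n) ℂ) (Fin L → MvPolynomial (Fin n) ℂ))
    (hN : HomogSol.IsPrimaryDecomposition (HomogSol.transposeModule P) N)
    {ρ : Fin μ → ℕ} (B : (σ : Fin μ) → Fin (ρ σ) → HomogSol.PolyDiffOp n L)
    (hB : ∀ σ, HomogSol.IsNoetherianFamily (N σ) (B σ))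
    (lam : ℂ) (Ω : Set (Fin n → ℝ)) (hΩ : HomogSol.IsOPC Ω) :
    HomogSol.homogFamily N B lam Ω ⊆
      HomogSol.solutionSpace P Ω ∩ HomogSol.homogSpaceVec L lam Ω := by
  open HomogSol MvPolynomial in
  rintro u ⟨σ, i, z, ⟨hzV, hzU⟩, hu⟩
  have hpos (x) (hx : x ∈ Ω) : 0 < (eval (pairPoint x z) (negPairing n)).re :=
    hΩ.re_negPairing_pos hn hx hzU
  have hul (l : Fin L) : Set.EqOn (fun x => u x l) (fun x =>
      realization (negPairing n) (powDeriv lam) (pairPoint x z) ((B σ i).symbol z l)) Ω := by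
    intro x hx
    simp only [hu hx]
    exact vecApply_kernel _ lam (hpos x hx) l
  have hφ (x) (hx : x ∈ Ω) (k : ℕ) := hasDerivAt_powDeriv lam k (hpos x hx)
  have hsmooth (l : Fin L) : ContDiffOn ℝ ∞ (fun x => u x l) Ω := by
    refine ContDiffOn.congr ?_ (hul l)
    -- Holomorphic in all 2n variables where Re τ > 0, then restricted to real x and fixed z.
    exact ((contDiffOn_realization (negPairing n) (contDiffOn_powDeriv lam)
      ((B σ i).symbol z l)).restrict_scalars ℝ).comp (contDiff_pairPoint_left z).contDiffOn hpos
  refine ⟨⟨contDiffOn_pi.2 hsmooth, fun j x hx => ?_⟩, fun l => ⟨hsmooth l, fun x hx => ?_⟩⟩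
  · have hrow : P j ∈ N σ := by
      have h : P j ∈ transposeModule P := by
        -- Pᵗ maps the j-th unit vector to the j-th row of P.
        refine ⟨Pi.single j 1, ?_⟩
        ext1 l
        simp
      rw [hN.iInf_eq] at h
      exact (Submodule.mem_iInf _).1 h σ
    have hzero := sum_realization_eq_zero (B σ i) (P j) z
      (fun q => (hB σ (q • P j)).1 ((N σ).smul_mem q hrow) i z hzV)
      -- The family starts at the m-th derivative of τ^λ because the order-m operator produces the
      -- factor Tᵐ.
      (fun k => powDeriv lam (k + m)) x
    rw [← realization_mul_X_pow, Finset.sum_mul, map_sum] at hzero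
    have hterm (l : Fin L) : constCoeffOp (P j l) (fun y => u y l) x = (-1) ^ m *
        realization (negPairing n) (powDeriv lam) (pairPoint x z)
          ((∑ α ∈ (B σ i).support, eval z (B σ i α l) • symbolMultiD (negPairing n) Sum.inr α
            (Polynomial.C (rename Sum.inr (P j l)))) * Polynomial.X ^ m) := by
      have h₁ : constCoeffOp (P j l) (fun y => u y l) x =
          realization (negPairing n) (powDeriv lam) (pairPoint x z)
            (∑ β ∈ (P j l).support, (P j l).coeff β •
              symbolMultiD (negPairing n) Sum.inl β ((B σ i).symbol z l)) := by
        simp only [constCoeffOp, map_sum, map_smul, smul_eq_mul]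
        refine Finset.sum_congr rfl fun β _ => ?_
        rw [multiD_eqOn_realization_left hΩ.isOpen hφ (hul l) β hx]
      have h₂ (α : Fin n →₀ ℕ) : ∑ β ∈ (P j l).support, (P j l).coeff β •
          symbolMultiD (negPairing n) Sum.inl β (symbolMultiD (negPairing n) Sum.inr α 1) =
          (-1 : ℂ) ^ m • (symbolMultiD (negPairing n) Sum.inr α
            (Polynomial.C (rename Sum.inr (P j l))) * Polynomial.X ^ m) := by
        rw [← symbolMultiD_mul_X_pow, ← map_smul, ← sum_coeff_smul_symbolMultiD_inl_one (hP j l),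
          map_sum]
        refine Finset.sum_congr rfl fun β _ => ?_
        rw [map_smul]
        exact congrArg _ (LinearMap.congr_fun (symbolMultiD_inl_inr_commute α β) 1)
      rw [h₁, ← smul_eq_mul, ← map_smul]
      congr 1
      simp only [PolyDiffOp.symbol, map_sum, map_smul, Finset.smul_sum, Finset.sum_mul]
      rw [Finset.sum_comm]
      refine Finset.sum_congr rfl fun α _ => ?_
      simp only [smul_comm _ (eval z (B σ i α l)), smul_mul_assoc]
      rw [← Finset.smul_sum, h₂]
    simp only [hterm]
    rw [← Finset.mul_sum, hzero, mul_zero]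
  · rw [eulerOp, sub_eq_zero]
    rw [Finset.sum_congr rfl fun k _ => by
      rw [partialD_eqOn_realization_left hΩ.isOpen hφ (hul l) k hx]]
    rw [← realization_symbolEuler, realization_symbolEuler_symbol _ _ (hpos x hx)]
    exact congrArg _ (hul l hx).symm
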